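/- Let $X$ be a real random variable (the channel input) with an arbitrary distribution of unit power, $\mathbb{E}[X^2]=1$, and let $N\sim\mathcal N(0,1)$ be independent of $X$. For $snr\ge 0$ put $$mmse(snr)=\mathbb{E}\Big[\big(X-\mathbb{E}[X\mid \sqrt{snr}\,X+N]\big)^2\Big],$$ and for $\psi>0$ let $$mmse^{-1}(\psi)=\inf\{snr\ge 0 : mmse(snr)\le\psi\}.$$ Define the mercury factor, for $\psi>0$, by $$G(\psi)=\begin{cases}\dfrac1\psi-mmse^{-1}(\psi), & 0<\psi\le 1,\\[1ex] 1, & \psi\ge 1.\end{cases}$$ Then: 1. For every $\psi\in(0,\mathrm{Var}(X)]$, $mmse^{-1}(\psi)$ is the unique $snr\ge 0$ with $mmse(snr)=\psi$. (So if $\mathbb{E}[X]=0$, then $mmse^{-1}$ is the ordinary inverse of $mmse$ on all of $(0,1]$.) 2. $mmse^{-1}(1)=0$, so the two cases in the definition of $G$ agree at $\psi=1$. 3. $G$ is monotonically decreasing (that is, non-increasing) on $(0,\infty)$. 4. Consequently, for every channel gain $\lambda>0$, the mercury level $$W\longmapsto \frac1\lambda\,G\!\left(\frac{1}{W\lambda}\right)$$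 is monotonically increasing (that is, non-decreasing) as a function of the water level $W\in(0,\infty)$. -/

import Mathlib

open MeasureTheory ProbabilityTheory

noncomputable section

namespace MercuryFactor

/-- The joint law of `(x, n)`: the channel input `x` has law `P`, and the noise `n` is a standard
real Gaussian independent of `x`. -/
def inputNoise (P : Measure ℝ) : Measure (ℝ × ℝ) :=
  P.prod (gaussianReal 0 1)

/-- The observation `√snr x + n` of the scalar Gaussian channel, as a function of `(x, n)`. -/
def observation (snr : ℝ) (ω : ℝ × ℝ) : ℝ :=
  √snr * ω.1 + ω.2

/-- The conditional mean estimator `E[x | √snr x + n]`. -/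
def estimator (P : Measure ℝ) (snr : ℝ) : ℝ × ℝ → ℝ :=
  (inputNoise P)[fun ω : ℝ × ℝ => ω.1 |
    MeasurableSpace.comap (observation snr) (inferInstance : MeasurableSpace ℝ)]

/-- The minimum mean-square error `E[(x - E[x | √snr x + n])²]` of an input of law `P`, as a
function of the signal-to-noise ratio `snr ≥ 0`. -/
def mmse (P : Measure ℝ) (snr : ℝ) : ℝ :=
  ∫ ω, (ω.1 - estimator P snr ω) ^ 2 ∂(inputNoise P)

/-- The inverse MMSE function: the smallest signal-to-noise ratio at which the error is at most
`ψ`. This agrees with the ordinary inverse of `mmse P` on `[0, ∞)` at every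
`ψ ∈ (0, Var P]` (the values attained there); for `ψ ≥ Var P = mmse P 0` its value is `0`. -/
def mmseInv (P : Measure ℝ) (ψ : ℝ) : ℝ :=
  sInf {snr : ℝ | 0 ≤ snr ∧ mmse P snr ≤ ψ}

/-- The mercury factor (meaningful for `ψ > 0`). -/
def mercuryFactor (P : Measure ℝ) (ψ : ℝ) : ℝ :=
  if ψ ≤ 1 then 1 / ψ - mmseInv P ψ else 1

/-- The mercury level of a stream with channel gain `gain`, as a function of the water level
`W`. -/
def mercuryLevel (P : Measure ℝ) (gain W : ℝ) : ℝ :=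
  1 / gain * mercuryFactor P (1 / (W * gain))

end MercuryFactor

end

open scoped ENNReal NNReal

namespace MercuryFactor

/-! Everything rests on `1 / mmse snr - snr` being non-decreasing, that is, on `mmse t ≤ mmse s / (1
+ (t - s) * mmse s)` for `s ≤ t` (`mmse_le_div`). No derivative of `mmse` is used: an observation at
gain `t`, with fresh Gaussian noise, simulates by a rotation two observations at gains `s` and `t -
s` with independent noises. Correcting the optimal estimate at `s` linearly by the second
observation, with the best coefficient, gives the bound (`mmse_le_linear`).

The bound yields strict decrease while `mmse` is positive, and `mmse t ≤ 1 / t`. With continuity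
(`continuous_mmse`) the intermediate value theorem makes every value in `(0, Var X]` attained
exactly once. Substituting `snr = mmseInv ψ` turns the key inequality into monotonicity of `1 / ψ -
mmseInv ψ`, hence of the mercury factor and the mercury level. -/

/-- The Pythagorean identity for the conditional expectation of a square-integrable function. -/
lemma integral_sub_sq_eq_condExp {Ω : Type*} {m m0 : MeasurableSpace Ω} {μ : Measure Ω}
    [IsFiniteMeasure μ] (hm : m ≤ m0) {X k : Ω → ℝ} (hX : MemLp X 2 μ) (hk : MemLp k 2 μ)
    (hkm : StronglyMeasurable[m] k) :
    ∫ ω, (X ω - k ω) ^ 2 ∂μ =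
      ∫ ω, (X ω - (μ[X | m]) ω) ^ 2 ∂μ + ∫ ω, ((μ[X | m]) ω - k ω) ^ 2 ∂μ := by
  have hE : MemLp (μ[X | m]) 2 μ := hX.condExp (by norm_num)
  have hd : MemLp (μ[X | m] - k) 2 μ := hE.sub hk
  have hr : MemLp (X - μ[X | m]) 2 μ := hX.sub hE
  have hXd : Integrable (X * (μ[X | m] - k)) μ := hX.integrable_mul hd
  have hEd : Integrable (μ[X | m] * (μ[X | m] - k)) μ := hE.integrable_mul hd
  have hrd : Integrable ((X - μ[X | m]) * (μ[X | m] - k)) μ := hr.integrable_mul hd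
  have hpull := condExp_mul_of_stronglyMeasurable_right
    (stronglyMeasurable_condExp.sub hkm) hXd (hX.integrable (by norm_num))
  have hcross : ∫ ω, ((X - μ[X | m]) * (μ[X | m] - k)) ω ∂μ = 0 := by
    rw [sub_mul, integral_sub' hXd hEd, ← integral_condExp hm, integral_congr_ae hpull, sub_self]
  have hexp : (fun ω => (X ω - k ω) ^ 2) = fun ω => ((X ω - (μ[X | m]) ω) ^ 2
      + ((μ[X | m]) ω - k ω) ^ 2) + 2 * ((X - μ[X | m]) * (μ[X | m] - k)) ω := by
    funext ω
    simp only [Pi.mul_apply, Pi.sub_apply]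
    ring
  have h1 : Integrable (fun ω => (X ω - (μ[X | m]) ω) ^ 2) μ := hr.integrable_sq
  have h2 : Integrable (fun ω => ((μ[X | m]) ω - k ω) ^ 2) μ := hd.integrable_sq
  rw [hexp, integral_add (by exact h1.add h2) (hrd.const_mul 2), integral_add h1 h2,
    integral_const_mul, hcross, mul_zero, add_zero]

/-- Conditional expectation is a contraction of `L²`. -/
lemma integral_condExp_sq_le {Ω : Type*} {m m0 : MeasurableSpace Ω} {μ : Measure Ω}
    [IsFiniteMeasure μ] (hm : m ≤ m0) {X : Ω → ℝ} (hX : MemLp X 2 μ) :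
    ∫ ω, ((μ[X | m]) ω) ^ 2 ∂μ ≤ ∫ ω, X ω ^ 2 ∂μ := by
  have h := integral_sub_sq_eq_condExp hm hX (k := fun _ => 0) (by simp) stronglyMeasurable_const
  simp only [sub_zero] at h
  have : 0 ≤ ∫ ω, (X ω - (μ[X | m]) ω) ^ 2 ∂μ := integral_nonneg fun _ => sq_nonneg _
  linarith

/-! ### The channel, its estimator and the optimality of the conditional mean -/

section

variable (P : Measure ℝ)

instance [IsProbabilityMeasure P] : IsProbabilityMeasure (inputNoise P) := by
  unfold inputNoise; infer_instance

@[fun_prop]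
lemma measurable_observation (s : ℝ) : Measurable (observation s) := by
  unfold observation; fun_prop

lemma comap_observation_le (s : ℝ) :
    MeasurableSpace.comap (observation s) (inferInstance : MeasurableSpace ℝ) ≤
      (inferInstance : MeasurableSpace (ℝ × ℝ)) :=
  (measurable_observation s).comap_le

lemma exists_estimator_eq (s : ℝ) :
    ∃ f : ℝ → ℝ, Measurable f ∧ ∀ ω, estimator P s ω = f (observation s ω) := by
  obtain ⟨f, hf, h⟩ := (stronglyMeasurable_condExp (μ := inputNoise P)
    (f := fun ω : ℝ × ℝ => ω.1) (m := MeasurableSpace.comap (observation s)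
      (inferInstance : MeasurableSpace ℝ))).measurable.exists_eq_measurable_comp
  exact ⟨f, hf, fun ω => congrFun h ω⟩

lemma mmse_nonneg (s : ℝ) : 0 ≤ mmse P s := integral_nonneg fun _ => sq_nonneg _

variable {P}

lemma memLp_fst_inputNoise (hP : MemLp id 2 P) : MemLp (fun ω : ℝ × ℝ => ω.1) 2 (inputNoise P) :=
  hP.comp_fst _

lemma memLp_estimator [IsProbabilityMeasure P] (hP : MemLp id 2 P) (s : ℝ) :
    MemLp (estimator P s) 2 (inputNoise P) :=
  (memLp_fst_inputNoise hP).condExp (by norm_num)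

/-- Only the error is assumed square-integrable: the estimator itself is then in `L²` as input minus
error, so the Pythagorean identity applies. -/
lemma mmse_le_of_estimator [IsProbabilityMeasure P] (hP : MemLp id 2 P) {s : ℝ}
    {g : ℝ → ℝ} (hg : Measurable g)
    (hint : Integrable (fun ω => (ω.1 - g (observation s ω)) ^ 2) (inputNoise P)) :
    mmse P s ≤ ∫ ω, (ω.1 - g (observation s ω)) ^ 2 ∂(inputNoise P) := by
  have hX := memLp_fst_inputNoise hP
  have hgm : Measurable fun ω => g (observation s ω) := hg.comp (measurable_observation s)
  have hd : MemLp (fun ω : ℝ × ℝ => ω.1 - g (observation s ω)) 2 (inputNoise P) :=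
    (memLp_two_iff_integrable_sq (measurable_fst.sub hgm).aestronglyMeasurable).2 hint
  have hk : MemLp (fun ω => g (observation s ω)) 2 (inputNoise P) := by
    convert! hX.sub hd using 1
    funext ω
    simp
  rw [integral_sub_sq_eq_condExp (comap_observation_le s) hX hk
    (hg.comp (comap_measurable _)).stronglyMeasurable]
  exact le_add_of_nonneg_right (integral_nonneg fun _ => sq_nonneg _)

end

/-! ### Splitting an observation into two, and the key inequality -/

/-- Rotation of the two noises of a pair of independent observations of one input. -/
lemma measurePreserving_rotate_noise (P : Measure ℝ) [IsProbabilityMeasure P] (θ : ℝ) :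
    MeasurePreserving (fun ω : (ℝ × ℝ) × ℝ =>
        ((ω.1.1, Real.cos θ * ω.1.2 - Real.sin θ * ω.2), Real.sin θ * ω.1.2 + Real.cos θ * ω.2))
      ((inputNoise P).prod (gaussianReal 0 1)) ((inputNoise P).prod (gaussianReal 0 1)) := by
  have hrot : MeasurePreserving (ContinuousLinearMap.rotation (E := ℝ) (-θ))
      ((gaussianReal 0 1).prod (gaussianReal 0 1)) ((gaussianReal 0 1).prod (gaussianReal 0 1)) :=
    ⟨by fun_prop, IsGaussian.map_rotation_eq_self_of_forall_strongDual_eq_zero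
      (fun L => by rw [integral_continuousLinearMap_gaussianReal]; simp) (-θ)⟩
  have hassoc := measurePreserving_prodAssoc P (gaussianReal 0 1) (gaussianReal 0 1)
  have h := (hassoc.symm _).comp (((MeasurePreserving.id P).prod hrot).comp hassoc)
  convert! h using 1
  funext ω
  change _ = ((ω.1.1, (ContinuousLinearMap.rotation (-θ) (ω.1.2, ω.2)).1),
    (ContinuousLinearMap.rotation (-θ) (ω.1.2, ω.2)).2)
  simp [ContinuousLinearMap.rotation_apply, sub_eq_add_neg]

/-- The mean-square error of an affine combination of an uncorrelated error and a standard
Gaussian. -/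
lemma integral_sub_gaussian_sq {Ω : Type*} [MeasurableSpace Ω] {μ : Measure Ω}
    [IsProbabilityMeasure μ] {e : Ω → ℝ} (he : MemLp e 2 μ) (b a : ℝ) :
    ∫ ω, (b * e ω.1 - a * ω.2) ^ 2 ∂(μ.prod (gaussianReal 0 1)) =
      b ^ 2 * ∫ ω, e ω ^ 2 ∂μ + a ^ 2 := by
  have hz : MemLp (fun z : ℝ => z) 2 (gaussianReal 0 1) := memLp_id_gaussianReal 2
  have h1 : Integrable (fun ω : Ω × ℝ => e ω.1 ^ 2) (μ.prod (gaussianReal 0 1)) :=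
    he.integrable_sq.comp_fst _
  have h2 : Integrable (fun ω : Ω × ℝ => ω.2 ^ 2) (μ.prod (gaussianReal 0 1)) :=
    hz.integrable_sq.comp_snd _
  have h3 : Integrable (fun ω : Ω × ℝ => e ω.1 * ω.2) (μ.prod (gaussianReal 0 1)) :=
    (he.integrable (by norm_num)).mul_prod (hz.integrable (by norm_num))
  have hvar : ∫ z, z ^ 2 ∂(gaussianReal 0 1) = 1 := by
    have h := variance_fun_id_gaussianReal (μ := 0) (v := 1)
    rwa [variance_of_integral_eq_zero (by fun_prop) (by simp), NNReal.coe_one] at h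
  have hexp : (fun ω : Ω × ℝ => (b * e ω.1 - a * ω.2) ^ 2) = fun ω =>
      b ^ 2 * e ω.1 ^ 2 + a ^ 2 * ω.2 ^ 2 - 2 * b * a * (e ω.1 * ω.2) := by
    funext ω; ring
  rw [hexp, integral_sub (by exact (h1.const_mul _).add (h2.const_mul _)) (h3.const_mul _),
    integral_add (h1.const_mul _) (h2.const_mul _), integral_const_mul, integral_const_mul,
    integral_const_mul, integral_prod_mul (fun x => e x) (fun z => z), integral_id_gaussianReal,
    integral_fun_fst (fun x => e x ^ 2), integral_fun_snd (fun z => z ^ 2), hvar]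
  simp

/-- Adding an independent observation of gain `t - s` improves the error at least as much as the
linear estimator does. -/
lemma mmse_le_linear {P : Measure ℝ} [IsProbabilityMeasure P] (hP : MemLp id 2 P) {s t : ℝ}
    (hs : 0 ≤ s) (hst : s ≤ t) (a : ℝ) :
    mmse P t ≤ (1 - a * √(t - s)) ^ 2 * mmse P s + a ^ 2 := by
  -- The angle below is built from `s / t`, so `t = 0` is treated apart.
  rcases (hs.trans hst).eq_or_lt with rfl | ht
  · obtain rfl : s = 0 := le_antisymm hst hs
    simp [sq_nonneg]
  obtain ⟨f, hf, hfe⟩ := exists_estimator_eq P s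
  obtain ⟨θ, hc, hd⟩ : ∃ θ : ℝ, √t * Real.cos θ = √s ∧ √t * Real.sin θ = √(t - s) := by
    have h0 : 0 ≤ s / t := by positivity
    have h1 : √(s / t) ≤ 1 := Real.sqrt_le_one.2 ((div_le_one ht).2 hst)
    refine ⟨Real.arccos √(s / t), ?_, ?_⟩
    · rw [Real.cos_arccos (by linarith [Real.sqrt_nonneg (s / t)]) h1, ← Real.sqrt_mul ht.le,
        mul_div_cancel₀ _ ht.ne']
    · rw [Real.sin_arccos, Real.sq_sqrt h0, ← Real.sqrt_mul ht.le, mul_sub, mul_one,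
        mul_div_cancel₀ _ ht.ne']
  set c := Real.cos θ
  set d := Real.sin θ
  set β := √(t - s)
  let e : ℝ × ℝ → ℝ := fun ω => ω.1 - estimator P s ω
  have he : MemLp e 2 (inputNoise P) := (memLp_fst_inputNoise hP).sub (memLp_estimator hP s)
  let H : (ℝ × ℝ) × ℝ → ℝ := fun ω => ((1 - a * β) * e ω.1 - a * ω.2) ^ 2
  have hHint : Integrable H ((inputNoise P).prod (gaussianReal 0 1)) :=
    (((he.comp_fst _).const_mul _).sub
      (((memLp_id_gaussianReal 2 : MemLp id 2 (gaussianReal 0 1)).comp_snd _).const_mul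
        _)).integrable_sq
  have hT := measurePreserving_rotate_noise P θ
  -- With `y` the observation at gain `t` and `z` fresh noise, `c * y - d * z` is an observation at
  -- gain `s` and `d * y + c * z` one at gain `t - s`, with independent noises. The innovation of
  -- the second relative to `f` is added with weight `a`.
  let g : ℝ → ℝ → ℝ := fun z y =>
    f (c * y - d * z) + a * (d * y + c * z - β * f (c * y - d * z))
  have hHT : ∀ ω : (ℝ × ℝ) × ℝ, H ((ω.1.1, c * ω.1.2 - d * ω.2), d * ω.1.2 + c * ω.2) =
      (ω.1.1 - g ω.2 (observation t ω.1)) ^ 2 := by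
    rintro ⟨⟨x, n⟩, z⟩
    have harg : observation s (x, c * n - d * z) = c * observation t (x, n) - d * z := by
      simp only [observation, ← hc]; ring
    simp only [H, e, g, hfe, harg]
    simp only [observation, ← hd]
    ring
  have hint : Integrable (fun ω : (ℝ × ℝ) × ℝ => (ω.1.1 - g ω.2 (observation t ω.1)) ^ 2)
      ((inputNoise P).prod (gaussianReal 0 1)) := by
    have h := hT.integrable_comp_of_integrable hHint
    exact h.congr (.of_forall hHT)
  -- For almost every fixed `z`, `g z` is an estimator based on the observation at gain `t` alone,
  -- so its error is at least `mmse P t`; then average over `z`.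
  calc mmse P t = ∫ _z, mmse P t ∂(gaussianReal 0 1) := by simp
    _ ≤ ∫ z, ∫ ω, (ω.1 - g z (observation t ω)) ^ 2 ∂(inputNoise P) ∂(gaussianReal 0 1) := by
        refine integral_mono_ae (integrable_const _) hint.integral_prod_right ?_
        filter_upwards [hint.prod_left_ae] with z hz
        exact mmse_le_of_estimator hP (by fun_prop) hz
    _ = ∫ ω, (ω.1.1 - g ω.2 (observation t ω.1)) ^ 2 ∂((inputNoise P).prod (gaussianReal 0 1)) :=
        (integral_prod_symm _ hint).symm
    _ = ∫ ω, H ω ∂((inputNoise P).prod (gaussianReal 0 1)) := by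
        have h := integral_map hT.measurable.aemeasurable
          (hT.map_eq.symm ▸ hHint.aestronglyMeasurable)
        rw [hT.map_eq] at h
        rw [h]
        exact integral_congr_ae (.of_forall fun ω => (hHT ω).symm)
    _ = (1 - a * β) ^ 2 * mmse P s + a ^ 2 := integral_sub_gaussian_sq he _ _

lemma mmse_le_div {P : Measure ℝ} [IsProbabilityMeasure P] (hP : MemLp id 2 P) {s t : ℝ}
    (hs : 0 ≤ s) (hst : s ≤ t) :
    mmse P t ≤ mmse P s / (1 + (t - s) * mmse P s) := by
  have hm := mmse_nonneg P s
  have hδ : 0 ≤ t - s := sub_nonneg.2 hst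
  have hD : 0 < 1 + (t - s) * mmse P s := by positivity
  -- This coefficient minimizes the quadratic `(1 - a * √(t - s)) ^ 2 * mmse P s + a ^ 2` in `a`.
  refine (mmse_le_linear hP hs hst (√(t - s) * mmse P s / (1 + (t - s) * mmse P s))).trans_eq ?_
  have h2 : √(t - s) ^ 2 = t - s := Real.sq_sqrt hδ
  generalize mmse P s = m at *
  generalize √(t - s) = β at *
  rw [← h2] at hD ⊢
  field_simp
  ring

/-- At zero gain the observation carries no information. -/
lemma mmse_zero (P : Measure ℝ) [IsProbabilityMeasure P] :
    mmse P 0 = variance id P := by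
  have hobs : observation 0 = Prod.snd := by funext ω; simp [observation]
  have hind : Indep (MeasurableSpace.comap (Prod.fst : ℝ × ℝ → ℝ) inferInstance)
      (MeasurableSpace.comap (observation 0) inferInstance) (inputNoise P) := by
    rw [hobs]
    exact indepFun_prod (X := id) (Y := id) measurable_id measurable_id
  have hE : estimator P 0 =ᵐ[inputNoise P] fun _ => ∫ x, x ∂P := by
    have h := condExp_indep_eq (measurable_fst.comap_le) (comap_observation_le 0)
      (f := fun ω : ℝ × ℝ => ω.1) (comap_measurable _).stronglyMeasurable hind
    refine h.trans (.of_forall fun _ => ?_)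
    change ∫ ω : ℝ × ℝ, ω.1 ∂(P.prod _) = _
    rw [integral_fun_fst (fun x => x)]; simp
  rw [variance_eq_integral measurable_id.aemeasurable, mmse,
    integral_congr_ae (g := fun ω => (ω.1 - ∫ x, x ∂P) ^ 2) (hE.mono fun ω h => by simp [h]),
    inputNoise, integral_fun_fst (fun x => (x - ∫ x, x ∂P) ^ 2)]
  simp


/-! ### Bayes' formula and continuity of the MMSE -/

/-- The integral of `b` against the unnormalized posterior density of the input, given the
observation `y` at amplitude `a`. -/
noncomputable def posteriorIntegral (P : Measure ℝ) (b : ℝ → ℝ) (a y : ℝ) : ℝ :=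
  ∫ x, b x * gaussianPDFReal 0 1 (y - a * x) ∂P

lemma continuous_gaussianPDFReal (m : ℝ) (v : ℝ≥0) : Continuous (gaussianPDFReal m v) := by
  rw [gaussianPDFReal_def]; fun_prop

lemma gaussianPDFReal_standard_le_one (x : ℝ) : gaussianPDFReal 0 1 x ≤ 1 := by
  have h1 : 1 ≤ √(2 * Real.pi * (1 : ℝ≥0)) := by
    rw [Real.one_le_sqrt, NNReal.coe_one]
    linarith [Real.pi_gt_three]
  have h2 : Real.exp (-(x - 0) ^ 2 / (2 * (1 : ℝ≥0))) ≤ 1 := by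
    rw [Real.exp_le_one_iff, NNReal.coe_one]
    nlinarith [sq_nonneg (x - 0)]
  rw [gaussianPDFReal]
  exact mul_le_one₀ (inv_le_one_of_one_le₀ h1) (Real.exp_nonneg _) h2

section

variable (P : Measure ℝ) [IsProbabilityMeasure P]

lemma integrable_posterior {b : ℝ → ℝ} (hb : Measurable b) {M : ℝ} (hM : ∀ x, |b x| ≤ M)
    (a y : ℝ) : Integrable (fun x => b x * gaussianPDFReal 0 1 (y - a * x)) P := by
  have hφ := measurable_gaussianPDFReal 0 1
  refine .of_bound (by fun_prop) M (.of_forall fun x => ?_)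
  rw [Real.norm_eq_abs, abs_mul, abs_of_nonneg (gaussianPDFReal_nonneg _ _ _), ← mul_one M]
  exact mul_le_mul (hM x) (gaussianPDFReal_standard_le_one _) (gaussianPDFReal_nonneg _ _ _)
    ((abs_nonneg _).trans (hM x))

lemma continuous_posteriorIntegral {b : ℝ → ℝ} (hb : Measurable b) {M : ℝ}
    (hM : ∀ x, |b x| ≤ M) :
    Continuous (fun p : ℝ × ℝ => posteriorIntegral P b p.1 p.2) := by
  have hφ := measurable_gaussianPDFReal 0 1
  have hφc := continuous_gaussianPDFReal 0 1
  refine continuous_of_dominated (bound := fun _ => M) (fun p => by fun_prop)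
    (fun p => .of_forall fun x => ?_) (integrable_const _) (.of_forall fun x => by fun_prop)
  rw [Real.norm_eq_abs, abs_mul, abs_of_nonneg (gaussianPDFReal_nonneg _ _ _), ← mul_one M]
  exact mul_le_mul (hM x) (gaussianPDFReal_standard_le_one _) (gaussianPDFReal_nonneg _ _ _)
    ((abs_nonneg _).trans (hM x))

lemma posteriorIntegral_one_pos (a y : ℝ) : 0 < posteriorIntegral P (fun _ => 1) a y := by
  have hint := integrable_posterior P (b := fun _ => 1) measurable_const (M := 1) (by simp) a y
  refine (integral_pos_iff_support_of_nonneg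
    (fun x => by simpa using gaussianPDFReal_nonneg _ _ _) hint).2 ?_
  have : Function.support (fun x => (1 : ℝ) * gaussianPDFReal 0 1 (y - a * x)) = Set.univ := by
    ext x
    simpa using (gaussianPDFReal_pos 0 1 (y - a * x) one_ne_zero).ne'
  rw [this]
  simp

lemma abs_posteriorIntegral_le {b : ℝ → ℝ} (hb : Measurable b) {M : ℝ} (hM : ∀ x, |b x| ≤ M)
    (a y : ℝ) : |posteriorIntegral P b a y| ≤ M * posteriorIntegral P (fun _ => 1) a y := by
  have hint := integrable_posterior P (b := fun _ => 1) measurable_const (M := 1) (by simp) a y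
  rw [posteriorIntegral, posteriorIntegral, ← integral_const_mul]
  refine (abs_integral_le_integral_abs).trans (integral_mono
    (integrable_posterior P hb hM a y).abs (hint.const_mul M) fun x => ?_)
  simp only [abs_mul, abs_of_nonneg (gaussianPDFReal_nonneg _ _ _), one_mul]
  exact mul_le_mul_of_nonneg_right (hM x) (gaussianPDFReal_nonneg _ _ _)

/-- Disintegration of the joint law of input and observation over the observation. -/
lemma integral_mul_comp_observation {b u : ℝ → ℝ} (hb : Measurable b) (hu : Measurable u)
    {M C : ℝ} (hM : ∀ x, |b x| ≤ M) (hC : ∀ y, |u y| ≤ C) (s : ℝ) :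
    ∫ ω, b ω.1 * u (observation s ω) ∂(inputNoise P) =
      ∫ y, u y * posteriorIntegral P b √s y := by
  have hφ := measurable_gaussianPDFReal 0 1
  have hφi := integrable_gaussianPDFReal 0 1
  -- The shear reduces integrability of the joint density to that of the Gaussian density in one
  -- variable.
  have hshear : MeasurePreserving (fun p : ℝ × ℝ => (p.1, p.2 - √s * p.1)) (P.prod volume)
      (P.prod volume) :=
    (MeasurePreserving.id P).skew_product (g := fun x y => y - √s * x) (by fun_prop)
      (.of_forall fun x => (measurePreserving_sub_right volume (√s * x)).map_eq)
  have hint : Integrable (Function.uncurry fun x y =>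
      b x * u y * gaussianPDFReal 0 1 (y - √s * x)) (P.prod volume) := by
    have h1 : Integrable (fun p : ℝ × ℝ => gaussianPDFReal 0 1 (p.2 - √s * p.1))
        (P.prod volume) :=
      hshear.integrable_comp_of_integrable (hφi.comp_snd P)
    refine h1.bdd_mul (c := M * C) (f := fun p : ℝ × ℝ => b p.1 * u p.2)
      (by fun_prop) (.of_forall fun p => ?_)
    rw [norm_mul]
    exact mul_le_mul (hM _) (hC _) (abs_nonneg _) ((abs_nonneg _).trans (hM p.1))
  have hbd : Integrable (fun ω => b ω.1 * u (observation s ω)) (inputNoise P) := by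
    refine .of_bound (by fun_prop) (M * C) (.of_forall fun ω => ?_)
    rw [norm_mul]
    exact mul_le_mul (hM _) (hC _) (abs_nonneg _) ((abs_nonneg _).trans (hM ω.1))
  calc ∫ ω, b ω.1 * u (observation s ω) ∂(inputNoise P)
      = ∫ x, (∫ n, b x * u (√s * x + n) ∂(gaussianReal 0 1)) ∂P := integral_prod _ hbd
    _ = ∫ x, (∫ y, b x * u y * gaussianPDFReal 0 1 (y - √s * x)) ∂P := by
        refine integral_congr_ae (.of_forall fun x => ?_)
        dsimp only
        rw [integral_gaussianReal_eq_integral_smul one_ne_zero, ← integral_add_left_eq_self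
          (fun y => b x * u y * gaussianPDFReal 0 1 (y - √s * x)) (√s * x)]
        refine integral_congr_ae (.of_forall fun n => ?_)
        simp [mul_comm]
    _ = ∫ y, (∫ x, b x * u y * gaussianPDFReal 0 1 (y - √s * x) ∂P) := integral_integral_swap hint
    _ = ∫ y, u y * posteriorIntegral P b √s y := by
        refine integral_congr_ae (.of_forall fun y => ?_)
        dsimp only
        rw [posteriorIntegral, ← integral_const_mul]
        refine integral_congr_ae (.of_forall fun x => ?_)
        dsimp only
        ring

/-- The posterior mean of `b` of the input, given the observation `y` at amplitude `a`. -/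
noncomputable def posteriorMean (b : ℝ → ℝ) (a y : ℝ) : ℝ :=
  posteriorIntegral P b a y / posteriorIntegral P (fun _ => 1) a y

lemma continuous_posteriorMean {b : ℝ → ℝ} (hb : Measurable b) {M : ℝ} (hM : ∀ x, |b x| ≤ M) :
    Continuous (fun p : ℝ × ℝ => posteriorMean P b p.1 p.2) :=
  (continuous_posteriorIntegral P hb hM).div
    (continuous_posteriorIntegral P (b := fun _ => 1) measurable_const (M := 1) (by simp))
    fun p => (posteriorIntegral_one_pos P p.1 p.2).ne'

lemma abs_posteriorMean_le {b : ℝ → ℝ} (hb : Measurable b) {M : ℝ} (hM : ∀ x, |b x| ≤ M)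
    (a y : ℝ) : |posteriorMean P b a y| ≤ M := by
  have hpos := posteriorIntegral_one_pos P a y
  rw [posteriorMean, abs_div, abs_of_pos hpos, div_le_iff₀ hpos]
  exact abs_posteriorIntegral_le P hb hM a y

/-- Bayes' formula for the scalar Gaussian channel. -/
lemma posteriorMean_ae_eq_condExp {b : ℝ → ℝ} (hb : Measurable b) {M : ℝ}
    (hM : ∀ x, |b x| ≤ M) (s : ℝ) :
    (fun ω => posteriorMean P b √s (observation s ω)) =ᵐ[inputNoise P]
      (inputNoise P)[fun ω : ℝ × ℝ => b ω.1 |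
        MeasurableSpace.comap (observation s) (inferInstance : MeasurableSpace ℝ)] := by
  have hmean : Measurable (posteriorMean P b √s) :=
    ((continuous_posteriorMean P hb hM).comp (Continuous.prodMk_right √s)).measurable
  have hM0 : 0 ≤ M := (abs_nonneg _).trans (hM 0)
  have hmeanint : Integrable (fun ω => posteriorMean P b √s (observation s ω)) (inputNoise P) :=
    .of_bound (hmean.comp (measurable_observation s)).aestronglyMeasurable M
      (.of_forall fun ω => abs_posteriorMean_le P hb hM _ _)
  refine ae_eq_condExp_of_forall_setIntegral_eq (comap_observation_le s)
    (.of_bound (hb.comp measurable_fst).aestronglyMeasurable M (.of_forall fun ω => hM _))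
    (fun A _ _ => hmeanint.integrableOn)
    ?_ (hmean.comp (comap_measurable _)).aestronglyMeasurable
  rintro _ ⟨B, hB, rfl⟩ -
  have hA : MeasurableSet (observation s ⁻¹' B) := measurable_observation s hB
  have hind : ∀ (v : ℝ → ℝ) (K : ℝ), 0 ≤ K → (∀ y, |v y| ≤ K) → ∀ y, |B.indicator v y| ≤ K :=
    fun v K hK hv y => by
      by_cases hy : y ∈ B
      · simpa [hy] using hv y
      · simpa [hy] using hK
  rw [← integral_indicator hA, ← integral_indicator hA]
  -- Both set integrals disintegrate to the integral over `B` of `posteriorIntegral P b √s`, since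
  -- the mean times its normalizer is that numerator.
  have h1 := integral_mul_comp_observation P (b := fun _ => 1) (M := 1) measurable_const
    (hmean.indicator hB) (by simp) (hind _ M hM0 (abs_posteriorMean_le P hb hM _)) s
  have h2 := integral_mul_comp_observation P hb (u := B.indicator fun _ => 1)
    (measurable_const.indicator hB) hM (hind _ 1 zero_le_one (by simp)) s
  calc _ = ∫ ω, 1 * B.indicator (posteriorMean P b √s) (observation s ω) ∂(inputNoise P) := by
        simp only [one_mul]; rfl
    _ = ∫ y, B.indicator (posteriorMean P b √s) y * posteriorIntegral P (fun _ => 1) √s y := h1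
    _ = ∫ y, B.indicator (fun _ => 1) y * posteriorIntegral P b √s y := by
        refine integral_congr_ae (.of_forall fun y => ?_)
        by_cases hy : y ∈ B
        · simp [hy, posteriorMean, div_mul_cancel₀ _ (posteriorIntegral_one_pos P √s y).ne']
        · simp [hy]
    _ = ∫ ω, b ω.1 * B.indicator (fun _ => 1) (observation s ω) ∂(inputNoise P) := h2.symm
    _ = _ := by
        refine integral_congr_ae (.of_forall fun ω => ?_)
        by_cases hy : observation s ω ∈ B <;> simp [hy]

/-- The error of the posterior mean of a bounded function of the input is continuous in the
signal-to-noise ratio. -/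
lemma continuous_integral_sub_posteriorMean_sq (hP : MemLp id 2 P) {b : ℝ → ℝ}
    (hb : Measurable b) {M : ℝ} (hM : ∀ x, |b x| ≤ M) :
    Continuous fun s => ∫ ω, (ω.1 - posteriorMean P b √s (observation s ω)) ^ 2
      ∂(inputNoise P) := by
  have hc := continuous_posteriorMean P hb hM
  refine continuous_of_dominated (bound := fun ω => 2 * ω.1 ^ 2 + 2 * M ^ 2)
    (fun s => ?_) (fun s => .of_forall fun ω => ?_)
    (((memLp_fst_inputNoise hP).integrable_sq.const_mul 2).add (integrable_const _))
    (.of_forall fun ω => ?_)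
  · have hmean : Measurable (posteriorMean P b √s) :=
      (hc.comp (Continuous.prodMk_right √s)).measurable
    exact ((measurable_fst.sub (hmean.comp (measurable_observation s))).pow_const
      2).aestronglyMeasurable
  · have h := sq_le_sq' (abs_le.1 (abs_posteriorMean_le P hb hM √s (observation s ω))).1
      (abs_le.1 (abs_posteriorMean_le P hb hM √s (observation s ω))).2
    rw [Real.norm_eq_abs, abs_of_nonneg (sq_nonneg _)]
    nlinarith [sq_nonneg (ω.1 + posteriorMean P b √s (observation s ω))]
  · have hobs : Continuous fun s => (√s, observation s ω) := by unfold observation; fun_prop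
    exact (continuous_const.sub (hc.comp hobs)).pow 2

/-- By Pythagoras the excess error is the second moment of `E[X - b(X) | Y]`, and conditional
expectation contracts `L²`. The bound does not depend on `s`, which gives uniform convergence under
truncation. -/
lemma abs_integral_posteriorMean_sub_mmse_le (hP : MemLp id 2 P) {b : ℝ → ℝ}
    (hb : Measurable b) {M : ℝ} (hM : ∀ x, |b x| ≤ M) (s : ℝ) :
    |∫ ω, (ω.1 - posteriorMean P b √s (observation s ω)) ^ 2 ∂(inputNoise P) - mmse P s| ≤
      ∫ x, (x - b x) ^ 2 ∂P := by
  have hm := comap_observation_le s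
  have hX := memLp_fst_inputNoise hP
  have hbL : MemLp (fun ω : ℝ × ℝ => b ω.1) 2 (inputNoise P) :=
    .of_bound (hb.comp measurable_fst).aestronglyMeasurable M (.of_forall fun ω => hM _)
  have hmean : Measurable (posteriorMean P b √s) :=
    ((continuous_posteriorMean P hb hM).comp (Continuous.prodMk_right √s)).measurable
  have hk : MemLp (fun ω => posteriorMean P b √s (observation s ω)) 2 (inputNoise P) :=
    .of_bound (hmean.comp (measurable_observation s)).aestronglyMeasurable M
      (.of_forall fun ω => abs_posteriorMean_le P hb hM _ _)
  have hpyth := integral_sub_sq_eq_condExp hm hX hk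
    (hmean.comp (comap_measurable _)).stronglyMeasurable
  have hsub := condExp_sub (hX.integrable (by norm_num)) (hbL.integrable (by norm_num))
    (MeasurableSpace.comap (observation s) (inferInstance : MeasurableSpace ℝ))
  have hle := integral_condExp_sq_le hm (hX.sub hbL)
  have hcongr := integral_congr_ae (μ := inputNoise P)
    (f := fun ω => (estimator P s ω - posteriorMean P b √s (observation s ω)) ^ 2)
    (g := fun ω => ((inputNoise P)[(fun ω : ℝ × ℝ => ω.1) - fun ω : ℝ × ℝ => b ω.1 |
      MeasurableSpace.comap (observation s) (inferInstance : MeasurableSpace ℝ)] ω) ^ 2) (by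
      filter_upwards [hsub, posteriorMean_ae_eq_condExp P hb hM s] with ω h1 h2
      rw [h1, h2]; rfl)
  have hfst : ∫ ω, (((fun ω : ℝ × ℝ => ω.1) - fun ω : ℝ × ℝ => b ω.1) ω) ^ 2 ∂(inputNoise P) =
      ∫ x, (x - b x) ^ 2 ∂P := by
    refine (integral_fun_fst (fun x => (x - b x) ^ 2)).trans ?_
    simp
  have hnn : 0 ≤ ∫ ω, (estimator P s ω - posteriorMean P b √s (observation s ω)) ^ 2
      ∂(inputNoise P) := integral_nonneg fun _ => sq_nonneg _
  rw [hpyth]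
  change |mmse P s + ∫ ω, (estimator P s ω - posteriorMean P b √s (observation s ω)) ^ 2
      ∂(inputNoise P) - mmse P s| ≤ _
  rw [add_sub_cancel_left, abs_of_nonneg hnn, hcongr]
  exact hle.trans_eq hfst

variable {P}

omit [IsProbabilityMeasure P] in
lemma tendsto_integral_sub_truncation_sq (hP : MemLp id 2 P) :
    Filter.Tendsto (fun k : ℕ => ∫ x, (x - (Set.Icc (-k : ℝ) k).indicator id x) ^ 2 ∂P)
      Filter.atTop (nhds 0) := by
  rw [← integral_zero ℝ ℝ (μ := P)]
  refine tendsto_integral_of_dominated_convergence (fun x => x ^ 2) (fun k => ?_)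
    hP.integrable_sq (fun k => .of_forall fun x => ?_) (.of_forall fun x => ?_)
  · have := (measurable_id (α := ℝ)).indicator (measurableSet_Icc (a := (-k : ℝ)) (b := k))
    fun_prop
  · by_cases hx : x ∈ Set.Icc (-k : ℝ) k
    · simp [Set.indicator_of_mem hx, sq_nonneg]
    · simp [Set.indicator_of_notMem hx]
  · obtain ⟨K, hK⟩ := exists_nat_ge |x|
    refine tendsto_const_nhds.congr' ?_
    filter_upwards [Filter.eventually_ge_atTop K] with k hk
    have hx : x ∈ Set.Icc (-k : ℝ) k := abs_le.1 (hK.trans (by exact_mod_cast hk))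
    simp [Set.indicator_of_mem hx]

/-- A uniform limit of the continuous errors obtained from truncated inputs. Continuity holds on all
of `ℝ` because `√s = 0` for negative `s`. -/
theorem continuous_mmse (hP : MemLp id 2 P) : Continuous (mmse P) := by
  have hmeas (k : ℕ) : Measurable ((Set.Icc (-k : ℝ) k).indicator id) :=
    measurable_id.indicator measurableSet_Icc
  have hbd (k : ℕ) (x : ℝ) : |(Set.Icc (-k : ℝ) k).indicator id x| ≤ k := by
    by_cases hx : x ∈ Set.Icc (-k : ℝ) k
    · simpa [Set.indicator_of_mem hx] using abs_le.2 hx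
    · simp [Set.indicator_of_notMem hx]
  have hunif : TendstoUniformly (fun (k : ℕ) s => ∫ ω, (ω.1 - posteriorMean P
      ((Set.Icc (-k : ℝ) k).indicator id) √s (observation s ω)) ^ 2 ∂(inputNoise P))
      (mmse P) Filter.atTop := by
    rw [Metric.tendstoUniformly_iff]
    intro ε hε
    filter_upwards [(tendsto_integral_sub_truncation_sq hP).eventually_lt_const hε] with k hk s
    rw [dist_comm, Real.dist_eq]
    exact (abs_integral_posteriorMean_sub_mmse_le P hP (hmeas k) (hbd k) s).trans_lt hk
  exact hunif.continuous (.of_forall fun k =>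
    continuous_integral_sub_posteriorMean_sq P hP (hmeas k) (hbd k))

end

/-! ### The inverse MMSE and the mercury factor -/

lemma memLp_two_of_integral_sq_ne_zero {P : Measure ℝ} (h : ∫ x, x ^ 2 ∂P ≠ 0) :
    MemLp id 2 P :=
  (memLp_two_iff_integrable_sq measurable_id.aestronglyMeasurable).2
    -- A non-integrable function has integral `0` by convention, so a nonzero second moment forces
    -- integrability.
    (not_imp_comm.1 integral_undef h)

section

variable {P : Measure ℝ} [IsProbabilityMeasure P] (hP : MemLp id 2 P)
include hP

lemma antitoneOn_mmse : AntitoneOn (mmse P) (Set.Ici 0) := fun s hs _ _ hst =>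
  (mmse_le_div hP hs hst).trans (div_le_self (mmse_nonneg P s) (le_add_of_nonneg_right
    (mul_nonneg (sub_nonneg.2 hst) (mmse_nonneg P s))))

/-- The key inequality: `1 / mmse snr - snr` is non-decreasing in `snr`. -/
lemma inv_mmse_sub_le {s t : ℝ} (hs : 0 ≤ s) (hst : s ≤ t) (ht : 0 < mmse P t) :
    1 / mmse P s - s ≤ 1 / mmse P t - t := by
  have hm : 0 < mmse P s := ht.trans_le (antitoneOn_mmse hP hs (hs.trans hst) hst)
  have hD : 0 < 1 + (t - s) * mmse P s := by
    have := mul_nonneg (sub_nonneg.2 hst) hm.le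
    linarith
  have h := one_div_le_one_div_of_le ht (mmse_le_div hP hs hst)
  rw [one_div_div, add_div, mul_div_cancel_right₀ _ hm.ne'] at h
  linarith

lemma mmse_lt_of_lt {s t : ℝ} (hs : 0 ≤ s) (hst : s < t) (hm : 0 < mmse P s) :
    mmse P t < mmse P s :=
  (mmse_le_div hP hs hst.le).trans_lt (div_lt_self hm (lt_add_of_pos_right _
    (mul_pos (sub_pos.2 hst) hm)))

lemma mmse_le_one_div {t : ℝ} (ht : 0 < t) : mmse P t ≤ 1 / t := by
  have hm := mmse_nonneg P 0
  refine (mmse_le_div hP le_rfl ht.le).trans ?_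
  rw [sub_zero, div_le_div_iff₀ (by positivity) ht]
  linarith [mul_comm t (mmse P 0)]

/-- Monotonicity and strict decrease at positive values make the set in the infimum exactly `Set.Ici
s`. -/
lemma mmseInv_eq_of_mmse_eq {s ψ : ℝ} (hψ : 0 < ψ) (hs : 0 ≤ s) (h : mmse P s = ψ) :
    mmseInv P ψ = s := by
  have hset : {snr : ℝ | 0 ≤ snr ∧ mmse P snr ≤ ψ} = Set.Ici s := by
    ext t
    constructor
    · rintro ⟨ht, hle⟩
      by_contra! hlt
      have h1 := antitoneOn_mmse hP ht hs (le_of_not_ge hlt)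
      exact absurd (mmse_lt_of_lt hP ht (not_le.1 hlt) (hψ.trans_le (h ▸ h1))) (by linarith)
    · intro ht
      exact ⟨hs.trans ht, h ▸ antitoneOn_mmse hP hs (hs.trans ht) ht⟩
  rw [mmseInv, hset, csInf_Ici]

/-- Intermediate values on `[0, 1 / ψ]`: the error starts at the variance and is at most `ψ` at gain
`1 / ψ`. -/
lemma exists_mmse_eq {ψ : ℝ} (hψ : ψ ∈ Set.Ioc 0 (variance id P)) : ∃ s, 0 ≤ s ∧ mmse P s = ψ := by
  have h0 : (0 : ℝ) ≤ 1 / ψ := one_div_nonneg.2 hψ.1.le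
  have h1 := mmse_le_one_div hP (one_div_pos.2 hψ.1)
  rw [one_div_one_div] at h1
  obtain ⟨s, hs, h⟩ := intermediate_value_Icc' h0 (continuous_mmse hP).continuousOn
    ⟨h1, (mmse_zero P).symm ▸ hψ.2⟩
  exact ⟨s, hs.1, h⟩

omit hP in
lemma mmseInv_eq_zero {ψ : ℝ} (hψ : variance id P ≤ ψ) : mmseInv P ψ = 0 := by
  have hmem : (0 : ℝ) ∈ {snr : ℝ | 0 ≤ snr ∧ mmse P snr ≤ ψ} := ⟨le_rfl, (mmse_zero P).trans_le hψ⟩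
  exact le_antisymm (csInf_le ⟨0, fun _ ht => ht.1⟩ hmem) (Real.sInf_nonneg fun _ ht => ht.1)

lemma antitoneOn_one_div_sub_mmseInv :
    AntitoneOn (fun ψ => 1 / ψ - mmseInv P ψ) (Set.Ioi 0) := by
  intro φ hφ ψ hψ hle
  have hφ' : 0 < φ := hφ
  have hinv : 1 / ψ ≤ 1 / φ := one_div_le_one_div_of_le hφ hle
  dsimp only
  rcases le_total (variance id P) φ with h1 | h1
  · rw [mmseInv_eq_zero h1, mmseInv_eq_zero (h1.trans hle)]
    linarith
  obtain ⟨t, ht, hmt⟩ := exists_mmse_eq hP ⟨hφ', h1⟩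
  rw [mmseInv_eq_of_mmse_eq hP hφ' ht hmt]
  rcases le_total (variance id P) ψ with h2 | h2
  -- Here the variance lies between `φ` and `ψ`: compare `φ` with the variance, the error at gain
  -- `0`, and then the variance with `ψ`.
  · have h := inv_mmse_sub_le hP le_rfl ht (hmt ▸ hφ')
    rw [mmse_zero, hmt] at h
    have := one_div_le_one_div_of_le (hφ'.trans_le h1) h2
    rw [mmseInv_eq_zero h2]
    linarith
  · obtain ⟨s, hs, hms⟩ := exists_mmse_eq hP (ψ := ψ) ⟨hψ, h2⟩
    rw [mmseInv_eq_of_mmse_eq hP hψ hs hms]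
    have hst : s ≤ t := by
      by_contra! hts
      have h3 := mmse_lt_of_lt hP ht hts (hmt ▸ hφ')
      linarith
    have h := inv_mmse_sub_le hP hs hst (hmt ▸ hφ')
    rwa [hms, hmt] at h

end

lemma mmseInv_one {P : Measure ℝ} [IsProbabilityMeasure P] (hpower : ∫ x, x ^ 2 ∂P = 1) :
    mmseInv P 1 = 0 :=
  mmseInv_eq_zero ((variance_le_expectation_sq measurable_id.aestronglyMeasurable).trans_eq hpower)

lemma antitoneOn_mercuryFactor {P : Measure ℝ} [IsProbabilityMeasure P]
    (hpower : ∫ x, x ^ 2 ∂P = 1) : AntitoneOn (mercuryFactor P) (Set.Ioi 0) := by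
  have hanti := antitoneOn_one_div_sub_mmseInv
    (memLp_two_of_integral_sq_ne_zero (P := P) (by simp [hpower]))
  intro φ hφ ψ hψ hle
  rcases le_or_gt ψ 1 with h | h
  · rw [mercuryFactor, mercuryFactor, if_pos h, if_pos (hle.trans h)]
    exact hanti hφ hψ hle
  · rw [mercuryFactor, if_neg h.not_ge, mercuryFactor]
    split_ifs with h1
    -- When `φ ≤ 1 < ψ`, the constant value `1` at `ψ` is the first branch at `1`.
    · simpa [mmseInv_one hpower] using hanti hφ (Set.mem_Ioi.2 one_pos) h1
    · exact le_rfl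

end MercuryFactor

theorem mainTheorem5 (P : MeasureTheory.Measure ℝ) [MeasureTheory.IsProbabilityMeasure P]
    (hpower : ∫ x, x ^ 2 ∂P = 1) :
    (∀ ψ ∈ Set.Ioc (0 : ℝ) (ProbabilityTheory.variance id P),
      0 ≤ MercuryFactor.mmseInv P ψ ∧
      MercuryFactor.mmse P (MercuryFactor.mmseInv P ψ) = ψ ∧
      ∀ snr : ℝ, 0 ≤ snr → MercuryFactor.mmse P snr = ψ → snr = MercuryFactor.mmseInv P ψ) ∧
    MercuryFactor.mercuryFactor P 1 = 1 ∧
    AntitoneOn (MercuryFactor.mercuryFactor P) (Set.Ioi 0) ∧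
    ∀ gain : ℝ, 0 < gain →
      MonotoneOn (MercuryFactor.mercuryLevel P gain) (Set.Ioi 0) := by
  have hP := MercuryFactor.memLp_two_of_integral_sq_ne_zero (P := P) (by simp [hpower])
  have hanti := MercuryFactor.antitoneOn_mercuryFactor hpower
  refine ⟨fun ψ hψ => ?_, ?_, hanti, fun gain hgain V hV W hW hVW => ?_⟩
  · obtain ⟨s, hs, h⟩ := MercuryFactor.exists_mmse_eq hP hψ
    rw [MercuryFactor.mmseInv_eq_of_mmse_eq hP hψ.1 hs h]
    exact ⟨hs, h, fun t ht hmt =>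
      (MercuryFactor.mmseInv_eq_of_mmse_eq hP hψ.1 ht hmt).symm.trans
        (MercuryFactor.mmseInv_eq_of_mmse_eq hP hψ.1 hs h)⟩
  · rw [MercuryFactor.mercuryFactor, if_pos le_rfl, MercuryFactor.mmseInv_one hpower]
    norm_num
  · have hVg : 0 < V * gain := mul_pos hV hgain
    have hWg : 0 < W * gain := mul_pos hW hgain
    exact mul_le_mul_of_nonneg_left
      (hanti (one_div_pos.2 hWg) (one_div_pos.2 hVg)
        (one_div_le_one_div_of_le hVg (mul_le_mul_of_nonneg_right hVW hgain.le)))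
      (one_div_nonneg.2 hgain.le)
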